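/- Let $\Sigma=(0,1]\times[0,+\infty)$, let $\rho$ be the measure on $\Sigma$ with $d\rho(u,v)=\frac{1}{1+uv}\,du\,dv$, and let $F$ be the map given by $$F(u,v)=\begin{cases}\left(v,\frac1v\left(\frac1u-1\right)\right)&\text{if }v<1,\\ (u,v-1)&\text{if }v\ge 1,\end{cases}$$ for $(u,v)\in\Sigma$ (the formula makes sense, and takes values in $\Sigma$, off the $\rho$-null segment $v=0$, so that all iterates $F^k$ are defined $\rho$-almost everywhere). Let $\alpha\in\mathbb R\setminus\mathbb Q$, let $g:(0,1)\to\mathbb R$ be a bounded function, let $h:\mathbb R\to\mathbb R$ be a continuous $\alpha$-periodic function, and suppose that $g$ is constant if $\int_0^\alpha h(v)\,dv\neq 0$. Let $f:\Sigma\to\mathbb C$ satisfy $f(u,v)=g(u)h(v)$ for all $u\in(0,1)$ and $v\ge 0$ (its values on the $\rho$-null half-line $u=1$ are arbitrary). Then there exists a constant $f^*\in\mathbb C$ such that for $\rho$-almost every $(u,v)\in\Sigma$ $$\lim_{n\to+\infty}\frac1n\sum_{k=0}^{n-1}f\bigl(F^k(u,v)\bigr)=f^*.$$ -/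

import Mathlib

open MeasureTheory Set Filter Topology

noncomputable section

/-- The strip `Σ = (0,1] × [0,∞)`. -/
def strip : Set (ℝ × ℝ) := Ioc (0 : ℝ) 1 ×ˢ Ici (0 : ℝ)

/-- The map `F` of the strip: `F(u,v) = (v, (1/v)(1/u - 1))` if `v < 1` and
`F(u,v) = (u, v - 1)` if `v ≥ 1`. It is written as a map of the plane; it sends every point
of the strip with `v ≠ 0` into the strip. On the null segment `v = 0` the
formula is meaningless, and the value there is irrelevant. -/
def stripMap (p : ℝ × ℝ) : ℝ × ℝ :=
  if p.2 < 1 then (p.2, 1 / p.2 * (1 / p.1 - 1)) else (p.1, p.2 - 1)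

/-- The measure `ρ` on the strip, `dρ(u,v) = du dv / (1 + u v)`, as a measure on the plane
concentrated on the strip. -/
def stripMeasure : Measure (ℝ × ℝ) :=
  ((volume : Measure (ℝ × ℝ)).restrict strip).withDensity
    (fun p => ENNReal.ofReal (1 / (1 + p.1 * p.2)))

end

/-!
The strip map is a slow version of Garrity's triangle map
`T(u,v) = (v, w - ⌊w⌋)`, `w = (1/v)(1/u - 1)`, on the open unit square: a point of the square is
sent to height `w` in the column over `v`, then descends that column by unit steps until it
reaches `T(u,v)`, after `⌊w⌋ + 1` steps in all.

Along a column the values of `f` are `g(v) h(w - j)`. Since `h` is continuous with irrational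
period, the sums of `h(w - j)` over `m` consecutive `j` equal `m` times the mean of `h`, up to an
error `ε m + C` with `C` independent of `w` (`exists_mean_of_periodic_irrational`). The hypothesis
on `g` makes `g(u)` times the mean a constant, which is the limit. The total error in a Birkhoff sum
of length `n` is therefore at most `ε n` plus a constant times the number of columns visited, and
only the boundedness of `g`, not its measurability, matters. It remains to see that the number of
columns visited is `o(n)`, that is, that the sums of the digits `⌊w⌋` along `T` grow superlinearly
almost everywhere (`ae_eventually_mul_le_sum_digit`).

This last point needs no ergodic theorem. The branches of `T` are projective and onto, and they
preserve the family of densities `u / (a + b u + c u v)³`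
(`lintegral_digit_mul_comp_triangleMap`). Conditionally on any finite sequence of digits, the next
iterate thus has such a density up to a factor, with `a > 0` and `b, c ≥ 0`. The mass of the density
is explicit, `1 / (2 a (a + b) (a + b + c))`, and it follows that the next digit is at least `k`
with conditional probability `r / (r + k) ≥ 1 / (1 + k)`, where `r = (a + b + c) / a`. The digits
hence dominate independent variables of infinite mean, and an exponential moment
estimate (`lintegral_weightProd_le`) with a summability argument gives superlinear growth.
-/

open scoped ENNReal

/-! ### Equidistribution of the rotation by one on a circle of irrational length -/

lemma integrable_haarAddCircle {T : ℝ} [Fact (0 < T)] (Q : C(AddCircle T, ℂ)) :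
    Integrable Q AddCircle.haarAddCircle :=
  Q.continuous.integrable_of_hasCompactSupport (HasCompactSupport.of_compactSpace _)

lemma fourier_neg_one_ne_one {T : ℝ} (hT : Irrational T) {n : ℤ} (hn : n ≠ 0) :
    fourier n ((-1 : ℝ) : AddCircle T) ≠ 1 := by
  have hT0 : (T : ℂ) ≠ 0 := by exact_mod_cast hT.ne_zero
  rw [fourier_coe_apply, Ne, Complex.exp_eq_one_iff]
  rintro ⟨k, hk⟩
  have h1 : ((-n : ℤ) : ℂ) = k * T := by
    have hpi : (2 * Real.pi * Complex.I : ℂ) ≠ 0 := Complex.two_pi_I_ne_zero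
    field_simp at hk
    push_cast at hk ⊢
    linear_combination hk
  have h2 : ((-n : ℤ) : ℝ) = k * T := by exact_mod_cast h1
  rcases eq_or_ne k 0 with rfl | hk0
  · simp at h2
    exact hn h2
  · exact (hT.intCast_mul hk0).ne_int (-n) h2.symm

/-- Trigonometric polynomials have bounded discrepancy under an irrational rotation: for a
nonconstant character the sums are geometric. -/
lemma exists_norm_sum_sub_integral_le_of_mem_span {T : ℝ} [Fact (0 < T)] (hT : Irrational T)
    {P : C(AddCircle T, ℂ)} (hP : P ∈ Submodule.span ℂ (range (@fourier T))) :
    ∃ C : ℝ, ∀ (x : AddCircle T) (m : ℕ),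
      ‖∑ j ∈ Finset.range m, (P (x - ((j : ℝ) : AddCircle T)) -
        ∫ t, P t ∂AddCircle.haarAddCircle)‖ ≤ C := by
  induction hP using Submodule.span_induction with
  | mem Q hQ =>
    obtain ⟨n, rfl⟩ := hQ
    have hI : ∫ t, fourier n t ∂(@AddCircle.haarAddCircle T _) = if n = 0 then 1 else 0 := by
      have := congrFun (fourierCoeff_fourier (T := T) n) 0
      simpa [fourierCoeff, Pi.single_apply, eq_comm] using this
    rw [hI]
    rcases eq_or_ne n 0 with rfl | hn
    · exact ⟨0, fun x m => by simp⟩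
    set r := fourier n ((-1 : ℝ) : AddCircle T) with hr
    have hr1 : r ≠ 1 := fourier_neg_one_ne_one hT hn
    have hrn : ‖r‖ = 1 := by rw [hr, fourier_apply, Circle.norm_coe]
    have hgeom : ∀ (x : AddCircle T) (j : ℕ),
        fourier n (x - ((j : ℝ) : AddCircle T)) = fourier n x * r ^ j := by
      intro x j
      induction j with
      | zero => simp
      | succ j ih =>
        have : x - (((j + 1 : ℕ) : ℝ) : AddCircle T)
            = (x - ((j : ℝ) : AddCircle T)) + ((-1 : ℝ) : AddCircle T) := by
          push_cast
          simp only [AddCircle.coe_neg, AddCircle.coe_add]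
          abel
        rw [this, fourier_apply, smul_add, AddCircle.toCircle_add, Circle.coe_mul,
          ← fourier_apply, ← fourier_apply, ih, pow_succ, mul_assoc]
    refine ⟨2 / ‖r - 1‖, fun x m => ?_⟩
    simp only [if_neg hn, sub_zero, hgeom]
    rw [← Finset.mul_sum, geom_sum_eq hr1, norm_mul, norm_div, fourier_apply, Circle.norm_coe,
      one_mul]
    gcongr
    calc ‖r ^ m - 1‖ ≤ ‖r ^ m‖ + ‖(1 : ℂ)‖ := norm_sub_le _ _
      _ = 2 := by rw [norm_pow, hrn]; norm_num
  | zero => exact ⟨0, fun x m => by simp⟩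
  | add P Q _ _ hP hQ =>
    obtain ⟨C, hC⟩ := hP
    obtain ⟨C', hC'⟩ := hQ
    refine ⟨C + C', fun x m => ?_⟩
    refine le_trans (le_of_eq ?_) ((norm_add_le _ _).trans (add_le_add (hC x m) (hC' x m)))
    rw [← Finset.sum_add_distrib]
    congr 1
    refine Finset.sum_congr rfl fun j _ => ?_
    simp only [ContinuousMap.add_apply]
    rw [integral_add (integrable_haarAddCircle P) (integrable_haarAddCircle Q)]
    ring
  | smul a P _ hP =>
    obtain ⟨C, hC⟩ := hP
    refine ⟨‖a‖ * C, fun x m => ?_⟩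
    refine le_trans (le_of_eq ?_) (mul_le_mul_of_nonneg_left (hC x m) (norm_nonneg a))
    rw [← norm_mul, Finset.mul_sum]
    congr 1
    refine Finset.sum_congr rfl fun j _ => ?_
    simp only [ContinuousMap.smul_apply, smul_eq_mul]
    rw [integral_const_mul]
    ring

/-- Unique ergodicity of an irrational rotation, in quantitative form. -/
lemma exists_norm_sum_sub_integral_le {T : ℝ} [Fact (0 < T)] (hT : Irrational T)
    (Q : C(AddCircle T, ℂ)) {ε : ℝ} (hε : 0 < ε) :
    ∃ C : ℝ, ∀ (x : AddCircle T) (m : ℕ),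
      ‖∑ j ∈ Finset.range m, (Q (x - ((j : ℝ) : AddCircle T)) -
        ∫ t, Q t ∂AddCircle.haarAddCircle)‖ ≤ ε * m + C := by
  have hQ : Q ∈ closure (Submodule.span ℂ (range (@fourier T)) : Set C(AddCircle T, ℂ)) := by
    rw [← Submodule.topologicalClosure_coe, span_fourier_closure_eq_top]
    trivial
  obtain ⟨P, hP, hPQ⟩ := Metric.mem_closure_iff.1 hQ (ε / 2) (by positivity)
  obtain ⟨C, hC⟩ := exists_norm_sum_sub_integral_le_of_mem_span hT hP
  rw [dist_eq_norm] at hPQ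
  have hpt : ∀ x, ‖(Q - P) x‖ ≤ ε / 2 := fun x => ((Q - P).norm_coe_le_norm x).trans hPQ.le
  have hmean : ‖∫ t, (Q - P) t ∂(@AddCircle.haarAddCircle T _)‖ ≤ ε / 2 := by
    simpa using norm_integral_le_of_norm_le_const (μ := @AddCircle.haarAddCircle T _)
      (Eventually.of_forall hpt)
  refine ⟨C, fun x m => ?_⟩
  have hsplit : ∑ j ∈ Finset.range m, (Q (x - ((j : ℝ) : AddCircle T)) -
        ∫ t, Q t ∂AddCircle.haarAddCircle) =
      ∑ j ∈ Finset.range m, ((Q - P) (x - ((j : ℝ) : AddCircle T)) -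
        ∫ t, (Q - P) t ∂AddCircle.haarAddCircle) +
      ∑ j ∈ Finset.range m, (P (x - ((j : ℝ) : AddCircle T)) -
        ∫ t, P t ∂AddCircle.haarAddCircle) := by
    rw [← Finset.sum_add_distrib]
    refine Finset.sum_congr rfl fun j _ => ?_
    simp only [ContinuousMap.sub_apply]
    rw [integral_sub (integrable_haarAddCircle Q) (integrable_haarAddCircle P)]
    ring
  rw [hsplit]
  refine (norm_add_le _ _).trans (add_le_add ?_ (hC x m))
  calc _ ≤ ∑ j ∈ Finset.range m, ε := by
        refine norm_sum_le_of_le _ fun j _ => (norm_sub_le _ _).trans ?_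
        linarith [hpt (x - ((j : ℝ) : AddCircle T))]
    _ = ε * m := by simp [mul_comm]

/-- A continuous function of irrational period `α` has a mean `c` along the integers, with a
discrepancy that is sublinear uniformly in the starting point; `α` may be negative. -/
lemma exists_mean_of_periodic_irrational {α : ℝ} (hα : Irrational α) {h : ℝ → ℝ}
    (hcont : Continuous h) (hper : Function.Periodic h α) :
    ∃ c : ℝ, (c ≠ 0 → (∫ v in (0 : ℝ)..α, h v) ≠ 0) ∧ ∀ ε > 0, ∃ C : ℝ, ∀ (x : ℝ) (m : ℕ),
      |∑ j ∈ Finset.range m, (h (x - j) - c)| ≤ ε * m + C := by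
  wlog hpos : 0 < α generalizing α
  · have hneg : 0 < -α := by
      have := hα.ne_zero
      rcases lt_or_gt_of_ne this with h1 | h1
      · linarith
      · exact absurd h1 hpos
    obtain ⟨c, hc, H⟩ := this hα.neg hper.neg hneg
    refine ⟨c, fun hc0 h0 => hc hc0 ?_, H⟩
    have h1 := hper.intervalIntegral_add_eq 0 (-α)
    rw [zero_add, h0, neg_add_cancel] at h1
    rw [intervalIntegral.integral_symm, ← h1, neg_zero]
  have : Fact (0 < α) := ⟨hpos⟩
  have hcl : Continuous (hper.lift) := hcont.quotient_lift _
  let Q : C(AddCircle α, ℂ) := ⟨fun x => (hper.lift x : ℂ), Complex.continuous_ofReal.comp hcl⟩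
  have hQ : ∀ x : ℝ, Q (x : AddCircle α) = (h x : ℂ) := fun x => rfl
  set c : ℝ := α⁻¹ * ∫ v in (0 : ℝ)..α, h v with hc
  have hI : ∫ t, Q t ∂AddCircle.haarAddCircle = (c : ℂ) := by
    rw [AddCircle.integral_haarAddCircle, ← AddCircle.intervalIntegral_preimage α 0, zero_add]
    simp only [hQ]
    rw [intervalIntegral.integral_ofReal, hc, Complex.real_smul, Complex.ofReal_mul]
  refine ⟨c, fun h0 h1 => h0 (by rw [hc, h1, mul_zero]), fun ε hε => ?_⟩
  obtain ⟨C, hC⟩ := exists_norm_sum_sub_integral_le hα Q hε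
  refine ⟨C, fun x m => ?_⟩
  have := hC x m
  rw [hI] at this
  simp only [← AddCircle.coe_sub, hQ] at this
  rw [← Real.norm_eq_abs, ← Complex.norm_real]
  push_cast
  exact this

/-! ### The triangle map as an acceleration of the strip map -/

/-- The height `(1/v)(1/u - 1)` of the column of the strip to which `(u,v)` is sent when `v < 1`. -/
noncomputable def columnHeight (p : ℝ × ℝ) : ℝ := 1 / p.2 * (1 / p.1 - 1)

/-- The integer part of the column height: the digit of the triangle map. -/
noncomputable def digit (p : ℝ × ℝ) : ℕ := ⌊columnHeight p⌋₊

/-- Garrity's triangle map in the coordinates `(u,v)`: the map induced by the strip map on the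
open unit square. -/
noncomputable def triangleMap (p : ℝ × ℝ) : ℝ × ℝ := (p.2, columnHeight p - digit p)

/-- The open unit square. -/
def unitSquare : Set (ℝ × ℝ) := Ioo (0 : ℝ) 1 ×ˢ Ioo (0 : ℝ) 1

lemma columnHeight_nonneg {p : ℝ × ℝ} (hp : p ∈ unitSquare) : 0 ≤ columnHeight p := by
  obtain ⟨⟨h1, h2⟩, h3, h4⟩ := hp
  have : 1 ≤ 1 / p.1 := by rw [le_div_iff₀ h1]; linarith
  exact mul_nonneg (by positivity) (by linarith)

lemma stripMap_iterate_of_le (u : ℝ) (i : ℕ) :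
    ∀ v : ℝ, (i : ℝ) ≤ v → stripMap^[i] (u, v) = (u, v - i) := by
  induction i with
  | zero => simp
  | succ i ih =>
    intro v hv
    push_cast at hv
    have h1 : ¬ v < 1 := by
      have : (0 : ℝ) ≤ i := by positivity
      linarith
    rw [Function.iterate_succ_apply, stripMap, if_neg h1, ih _ (by simp only; linarith)]
    push_cast
    ext <;> simp only; ring

lemma stripMap_of_mem {p : ℝ × ℝ} (hp : p ∈ unitSquare) :
    stripMap p = (p.2, columnHeight p) := by
  rw [stripMap, if_pos hp.2.2, columnHeight]

lemma stripMap_iterate_digit {p : ℝ × ℝ} (hp : p ∈ unitSquare) :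
    stripMap^[digit p + 1] p = triangleMap p := by
  rw [Function.iterate_succ_apply, stripMap_of_mem hp,
    stripMap_iterate_of_le _ (digit p) _ (Nat.floor_le (columnHeight_nonneg hp)), triangleMap]

lemma norm_birkhoffSum_le_of_le_digit {e : ℝ × ℝ → ℂ} {ε C : ℝ}
    (hcol : ∀ u ∈ Ioo (0 : ℝ) 1, ∀ (v : ℝ) (m : ℕ), 0 ≤ v → (m : ℝ) ≤ v + 1 →
      ‖∑ j ∈ Finset.range m, e (u, v - j)‖ ≤ ε * m + C)
    {p : ℝ × ℝ} (hp : p ∈ unitSquare) {n : ℕ} (hn : n ≤ digit p) :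
    ‖birkhoffSum stripMap e (n + 1) p‖ ≤ ε * (n + 1 : ℕ) + 2 * C := by
  have hw := columnHeight_nonneg hp
  have hn' : (n : ℝ) ≤ columnHeight p := (Nat.le_floor_iff hw).1 hn
  have h1 := hcol p.1 hp.1 p.2 1 hp.2.1.le (by push_cast; linarith [hp.2.1])
  have h2 := hcol p.2 hp.2 (columnHeight p) n hw (by linarith)
  have h3 : birkhoffSum stripMap e n (stripMap p)
      = ∑ j ∈ Finset.range n, e (p.2, columnHeight p - j) := by
    rw [stripMap_of_mem hp, birkhoffSum]
    refine Finset.sum_congr rfl fun j hj => ?_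
    rw [stripMap_iterate_of_le]
    exact le_trans (by exact_mod_cast (Finset.mem_range.1 hj).le) hn'
  rw [birkhoffSum_succ', h3]
  simp only [Finset.range_one, Finset.sum_singleton, Nat.cast_zero, sub_zero, Nat.cast_one] at h1
  refine (norm_add_le _ _).trans ?_
  push_cast
  linarith

/-- If the sums of `e` down each column are small, then so is a Birkhoff sum of length `n` over the
strip map, up to an error proportional to the number `N` of complete columns visited. -/
lemma exists_norm_birkhoffSum_le {e : ℝ × ℝ → ℂ} {ε C : ℝ} (hC : 0 ≤ C)
    (hcol : ∀ u ∈ Ioo (0 : ℝ) 1, ∀ (v : ℝ) (m : ℕ), 0 ≤ v → (m : ℝ) ≤ v + 1 →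
      ‖∑ j ∈ Finset.range m, e (u, v - j)‖ ≤ ε * m + C) (n : ℕ) :
    ∀ p : ℝ × ℝ, (∀ j, triangleMap^[j] p ∈ unitSquare) →
      ∃ N : ℕ, ∑ j ∈ Finset.range N, digit (triangleMap^[j] p) ≤ n ∧
        ‖birkhoffSum stripMap e n p‖ ≤ ε * n + 2 * C * (N + 1) := by
  induction n using Nat.strong_induction_on with
  | _ n ih =>
    intro p hp
    have hp0 : p ∈ unitSquare := hp 0
    rcases n with _ | n
    · exact ⟨0, by simp, by simpa using hC⟩
    rcases le_or_gt n (digit p) with hn | hn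
    · refine ⟨0, by simp, ?_⟩
      simpa using norm_birkhoffSum_le_of_le_digit hcol hp0 hn
    -- the first column is complete, and the induction hypothesis covers the rest of the orbit
    obtain ⟨k, rfl⟩ := Nat.exists_eq_add_of_lt hn
    obtain ⟨N, hN, hb⟩ := ih (k + 1) (by omega) (triangleMap p) fun j => by
      simpa only [← Function.iterate_succ_apply] using hp (j + 1)
    refine ⟨N + 1, ?_, ?_⟩
    · rw [Finset.sum_range_succ']
      simp only [Function.iterate_succ_apply, Function.iterate_zero, id]
      omega
    · have hfirst := norm_birkhoffSum_le_of_le_digit hcol hp0 le_rfl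
      have hsplit : digit p + k + 1 + 1 = (digit p + 1) + (k + 1) := by ring
      rw [hsplit, birkhoffSum_add, stripMap_iterate_digit hp0]
      refine (norm_add_le _ _).trans ((add_le_add hfirst hb).trans (le_of_eq ?_))
      push_cast
      ring

/-- The Birkhoff sums are sublinear along an orbit whose digits have superlinear sums. -/
lemma exists_norm_birkhoffSum_le_of_digit_sums {e : ℝ × ℝ → ℂ}
    (hcol : ∀ ε > 0, ∃ C : ℝ, ∀ u ∈ Ioo (0 : ℝ) 1, ∀ (v : ℝ) (m : ℕ), 0 ≤ v → (m : ℝ) ≤ v + 1 →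
      ‖∑ j ∈ Finset.range m, e (u, v - j)‖ ≤ ε * m + C)
    {p : ℝ × ℝ} (hp : ∀ j, triangleMap^[j] p ∈ unitSquare)
    (hgrow : ∀ K : ℕ, ∀ᶠ N in atTop, K * N ≤ ∑ j ∈ Finset.range N, digit (triangleMap^[j] p)) :
    ∀ ε > 0, ∃ B : ℝ, ∀ n : ℕ, ‖birkhoffSum stripMap e n p‖ ≤ ε * n + B := by
  intro ε hε
  obtain ⟨C, hC⟩ := hcol (ε / 2) (by positivity)
  obtain ⟨K, hK⟩ := exists_nat_ge (4 * |C| / ε)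
  obtain ⟨N₀, hN₀⟩ := eventually_atTop.1 (hgrow K)
  refine ⟨2 * |C| * (N₀ + 1), fun n => ?_⟩
  obtain ⟨N, hN, hb⟩ := exists_norm_birkhoffSum_le (abs_nonneg C)
    (fun u hu v m hv hm => (hC u hu v m hv hm).trans (by gcongr; exact le_abs_self C)) n p hp
  refine hb.trans ?_
  have hC0 := abs_nonneg C
  rcases le_total N N₀ with h | h
  · have h' : (N : ℝ) ≤ N₀ := by exact_mod_cast h
    have : 2 * |C| * (N + 1) ≤ 2 * |C| * (N₀ + 1) := by gcongr
    have : 0 ≤ ε * n := by positivity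
    linarith
  · have h1 : (K : ℝ) * N ≤ n := by exact_mod_cast (hN₀ N h).trans hN
    have h2 : 4 * |C| ≤ K * ε := (div_le_iff₀ hε).1 hK
    have h3 : 4 * |C| * N ≤ ε * n := by
      calc 4 * |C| * N ≤ K * ε * N := by gcongr
        _ = ε * (K * N) := by ring
        _ ≤ ε * n := by gcongr
    have h4 : 0 ≤ 2 * |C| * N₀ := by positivity
    linarith

/-! ### Transfer of the projective densities -/

/-- The density `u / (a + b u + c u v)³`. In the coordinates `x = u`, `y = u v` on the triangle
`0 < y < x < 1` it is the inverse cube of an affine form, which is the shape of the Jacobians of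
projective maps; `u` is the Jacobian of this change of coordinates. -/
noncomputable def projDensity (a b c : ℝ) (p : ℝ × ℝ) : ℝ≥0∞ :=
  ENNReal.ofReal (p.1 / (a + b * p.1 + c * p.1 * p.2) ^ 3)

/-- The total mass of `projDensity a b c` on the unit square. -/
noncomputable def projMass (a b c : ℝ) : ℝ := 1 / (2 * a * (a + b) * (a + b + c))

@[fun_prop]
lemma measurable_projDensity (a b c : ℝ) : Measurable (projDensity a b c) := by
  unfold projDensity
  fun_prop

@[fun_prop]
lemma measurable_columnHeight : Measurable columnHeight := by
  unfold columnHeight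
  fun_prop

@[fun_prop]
lemma measurable_digit : Measurable digit :=
  Nat.measurable_floor.comp measurable_columnHeight

@[fun_prop]
lemma measurable_triangleMap : Measurable triangleMap := by
  have : Measurable fun p => ((digit p : ℕ) : ℝ) := measurable_from_nat.comp measurable_digit
  unfold triangleMap
  fun_prop

lemma measurableSet_unitSquare : MeasurableSet unitSquare :=
  measurableSet_Ioo.prod measurableSet_Ioo

lemma volume_restrict_unitSquare :
    (volume : Measure (ℝ × ℝ)).restrict unitSquare =
      (volume.restrict (Ioo (0 : ℝ) 1)).prod (volume.restrict (Ioo (0 : ℝ) 1)) := by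
  rw [unitSquare, Measure.prod_restrict, Measure.volume_eq_prod]

lemma lintegral_Ioi_eq_tsum (H : ℝ → ℝ≥0∞) :
    ∫⁻ w in Ioi (0 : ℝ), H w = ∑' k : ℕ, ∫⁻ x in Ioo (0 : ℝ) 1, H (k + x) := by
  have hU : Ici (0 : ℝ) = ⋃ k : ℕ, Ico (k : ℝ) (k + 1) := by
    ext w
    simp only [mem_Ici, mem_iUnion, mem_Ico]
    refine ⟨fun h => ⟨⌊w⌋₊, Nat.floor_le h, Nat.lt_floor_add_one w⟩, ?_⟩
    rintro ⟨k, hk, -⟩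
    exact le_trans (by positivity) hk
  have hd : Pairwise (Function.onFun Disjoint fun k : ℕ => Ico (k : ℝ) (k + 1)) := by
    intro i j hij
    refine Set.disjoint_left.2 fun w hi hj => hij ?_
    have h1 : i < j + 1 := by exact_mod_cast hi.1.trans_lt hj.2
    have h2 : j < i + 1 := by exact_mod_cast hj.1.trans_lt hi.2
    omega
  rw [setLIntegral_congr Ioi_ae_eq_Ici, hU, lintegral_iUnion (fun k => measurableSet_Ico) hd]
  refine tsum_congr fun k => ?_
  rw [setLIntegral_congr (Ioo_ae_eq_Ico (μ := volume) (a := (k : ℝ)) (b := k + 1)).symm]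
  have hp := (measurePreserving_add_left (volume : Measure ℝ)
    (k : ℝ)).setLIntegral_comp_preimage_emb (measurableEmbedding_addLeft (k : ℝ)) H (Ioo (k : ℝ) (k + 1))
  rw [← hp]
  congr 2
  ext x
  simp

/-- The substitution `u = 1 / (1 + v w)`, the inverse of `w = (1/v)(1/u - 1)`. -/
lemma lintegral_Ioo_eq_lintegral_Ioi {v : ℝ} (hv : 0 < v) (f : ℝ → ℝ≥0∞) :
    ∫⁻ u in Ioo (0 : ℝ) 1, f u =
      ∫⁻ w in Ioi (0 : ℝ), ENNReal.ofReal (v / (1 + v * w) ^ 2) * f (1 / (1 + v * w)) := by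
  have himg : (fun w : ℝ => 1 / (1 + v * w)) '' Ioi 0 = Ioo 0 1 := by
    ext u
    simp only [mem_image, mem_Ioi, mem_Ioo]
    constructor
    · rintro ⟨w, hw, rfl⟩
      have : 0 < v * w := by positivity
      refine ⟨by positivity, ?_⟩
      rw [div_lt_one (by positivity)]
      linarith
    · rintro ⟨h0, h1⟩
      refine ⟨1 / v * (1 / u - 1), ?_, by field_simp; ring⟩
      have : 1 < 1 / u := by rw [lt_div_iff₀ h0]; linarith
      exact mul_pos (by positivity) (by linarith)
  have hder : ∀ w ∈ Ioi (0 : ℝ), HasDerivWithinAt (fun w : ℝ => 1 / (1 + v * w))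
      (-(v / (1 + v * w) ^ 2)) (Ioi 0) w := by
    intro w hw
    have hw : 0 < w := hw
    have hne : 1 + v * w ≠ 0 := by positivity
    have h1 : HasDerivAt (fun w : ℝ => 1 + v * w) v w := by
      simpa using ((hasDerivAt_id w).const_mul v).const_add 1
    have h2 := h1.inv hne
    simp only [one_div]
    rw [← neg_div]
    exact h2.hasDerivWithinAt
  have hinj : InjOn (fun w : ℝ => 1 / (1 + v * w)) (Ioi 0) := by
    intro x hx y hy hxy
    have hx : 0 < x := hx
    have hy : 0 < y := hy
    have hx' : 0 < 1 + v * x := by positivity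
    have hy' : 0 < 1 + v * y := by positivity
    simp only at hxy
    field_simp at hxy
    have h : v * (x - y) = 0 := by linarith
    rcases mul_eq_zero.1 h with h | h
    · exact absurd h hv.ne'
    · linarith
  rw [← himg, lintegral_image_eq_lintegral_abs_deriv_mul measurableSet_Ioi hder hinj]
  refine setLIntegral_congr_fun measurableSet_Ioi fun w hw => ?_
  simp only [abs_neg]
  rw [abs_of_nonneg (by positivity)]

lemma columnHeight_one_div {v w : ℝ} (hv : 0 < v) (hw : 0 < w) :
    columnHeight (1 / (1 + v * w), v) = w := by
  have : 0 < 1 + v * w := by positivity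
  simp only [columnHeight]
  field_simp
  ring

lemma jacobian_mul_projDensity {a b c v w : ℝ} (ha : 0 < a) (hb : 0 ≤ b) (hc : 0 ≤ c)
    (hv : 0 < v) (hw : 0 < w) (k x : ℝ) (hwk : w = k + x) :
    ENNReal.ofReal (v / (1 + v * w) ^ 2) * projDensity a b c (1 / (1 + v * w), v) =
      projDensity (a + b) (a * k + c) a (v, x) := by
  have hs : 0 < 1 + v * w := by positivity
  have hq : 0 < a * (1 + v * w) + b + c * v := by positivity
  simp only [projDensity]
  rw [← ENNReal.ofReal_mul (by positivity)]
  congr 1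
  have h1 : a + b * (1 / (1 + v * w)) + c * (1 / (1 + v * w)) * v
      = (a * (1 + v * w) + b + c * v) / (1 + v * w) := by field_simp
  have h2 : a + b + (a * k + c) * v + a * v * x = a * (1 + v * w) + b + c * v := by
    rw [hwk]; ring
  rw [h1, h2]
  field_simp

/-- The family of densities `projDensity` is stable under the branches of the triangle map: each
branch is onto, and the part of the density carried by digit `k` is transported to the
density with parameters `(a + b, a k + c, a)`. -/
lemma lintegral_digit_mul_comp_triangleMap {a b c : ℝ} (ha : 0 < a) (hb : 0 ≤ b) (hc : 0 ≤ c)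
    (φ : ℕ → ℝ≥0∞) {G : ℝ × ℝ → ℝ≥0∞} (hG : Measurable G) :
    ∫⁻ p in unitSquare, φ (digit p) * G (triangleMap p) * projDensity a b c p =
      ∑' k : ℕ, φ k * ∫⁻ p in unitSquare, G p * projDensity (a + b) (a * k + c) a p := by
  have hφ : Measurable fun p => φ (digit p) := measurable_from_nat.comp measurable_digit
  have hGT : Measurable fun p => G (triangleMap p) := hG.comp measurable_triangleMap
  rw [volume_restrict_unitSquare, lintegral_prod_symm' _ (by fun_prop)]
  have hfib : ∀ v ∈ Ioo (0 : ℝ) 1,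
      ∫⁻ u in Ioo (0 : ℝ) 1,
          φ (digit (u, v)) * G (triangleMap (u, v)) * projDensity a b c (u, v) =
        ∑' k : ℕ, φ k *
          ∫⁻ x in Ioo (0 : ℝ) 1, G (v, x) * projDensity (a + b) (a * k + c) a (v, x) := by
    rintro v ⟨hv, -⟩
    rw [lintegral_Ioo_eq_lintegral_Ioi hv, lintegral_Ioi_eq_tsum]
    refine tsum_congr fun k => ?_
    rw [← lintegral_const_mul _ (by fun_prop)]
    refine setLIntegral_congr_fun measurableSet_Ioo fun x hx => ?_
    have hw : 0 < (k : ℝ) + x := by have := hx.1; positivity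
    have hd : digit (1 / (1 + v * (k + x)), v) = k := by
      rw [digit, columnHeight_one_div hv hw, Nat.floor_eq_iff hw.le]
      exact ⟨by linarith [hx.1], by linarith [hx.2]⟩
    have hT : triangleMap (1 / (1 + v * (k + x)), v) = (v, x) := by
      rw [triangleMap, hd, columnHeight_one_div hv hw]
      simp
    rw [hd, hT, ← jacobian_mul_projDensity ha hb hc hv hw k x rfl]
    ring
  rw [setLIntegral_congr_fun measurableSet_Ioo hfib, lintegral_tsum]
  · refine tsum_congr fun k => ?_
    rw [lintegral_const_mul, lintegral_prod _ (by fun_prop)]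
    exact Measurable.lintegral_prod_right' (f := fun p : ℝ × ℝ =>
      G p * projDensity (a + b) (a * k + c) a p) (by fun_prop)
  · intro k
    refine (Measurable.const_mul ?_ _).aemeasurable
    exact Measurable.lintegral_prod_right' (f := fun p : ℝ × ℝ =>
      G p * projDensity (a + b) (a * k + c) a p) (by fun_prop)

lemma lintegral_Ioo_ofReal_of_hasDerivAt {F f : ℝ → ℝ}
    (hF : ∀ x ∈ Icc (0 : ℝ) 1, HasDerivAt F (f x) x) (hf : ContinuousOn f (Icc 0 1))
    (hf0 : ∀ x ∈ Icc (0 : ℝ) 1, 0 ≤ f x) :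
    ∫⁻ x in Ioo (0 : ℝ) 1, ENNReal.ofReal (f x) = ENNReal.ofReal (F 1 - F 0) := by
  have hI : IntegrableOn f (Ioc 0 1) := (hf.integrableOn_Icc).mono_set Ioc_subset_Icc_self
  have hFTC := intervalIntegral.integral_eq_sub_of_hasDerivAt (a := 0) (b := 1) (f := F)
    (f' := f) (by rwa [uIcc_of_le zero_le_one])
    ((intervalIntegrable_iff_integrableOn_Ioc_of_le zero_le_one).2 hI)
  rw [setLIntegral_congr Ioo_ae_eq_Ioc, ← hFTC, intervalIntegral.integral_of_le zero_le_one,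
    ofReal_integral_eq_lintegral_ofReal hI]
  exact (ae_restrict_iff' measurableSet_Ioc).2
    (Eventually.of_forall fun x hx => hf0 x (Ioc_subset_Icc_self hx))

lemma lintegral_projDensity {a b c : ℝ} (ha : 0 < a) (hb : 0 ≤ b) (hc : 0 ≤ c) :
    ∫⁻ p in unitSquare, projDensity a b c p = ENNReal.ofReal (projMass a b c) := by
  rw [volume_restrict_unitSquare, lintegral_prod_symm' _ (by fun_prop)]
  have hfib : ∀ v ∈ Ioo (0 : ℝ) 1, ∫⁻ u in Ioo (0 : ℝ) 1, projDensity a b c (u, v) =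
      ENNReal.ofReal (1 / (2 * a * (a + b + c * v) ^ 2)) := by
    rintro v ⟨hv, -⟩
    set B := b + c * v with hB
    have hB0 : 0 ≤ B := by positivity
    have key := lintegral_Ioo_ofReal_of_hasDerivAt
      (F := fun u => u ^ 2 / (2 * a * (a + B * u) ^ 2)) (f := fun u => u / (a + B * u) ^ 3)
      (fun u hu => by
        have hu0 := hu.1
        have hpos : 0 < a + B * u := by positivity
        have h1 : HasDerivAt (fun u : ℝ => a + B * u) B u := by
          simpa using ((hasDerivAt_id u).const_mul B).const_add a
        have hne : 2 * a * (a + B * u) ^ 2 ≠ 0 := by positivity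
        have h2 := (hasDerivAt_pow 2 u).div ((h1.pow 2).const_mul (2 * a)) hne
        refine h2.congr_deriv ?_
        simp only [Pi.pow_apply]
        field_simp
        push_cast
        ring)
      (ContinuousOn.div continuousOn_id (by fun_prop) fun u hu => by
        have hu0 := hu.1
        positivity)
      (fun u hu => by have hu0 := hu.1; positivity)
    simp only [projDensity]
    have h3 : ∀ u : ℝ, a + b * u + c * u * v = a + B * u := fun u => by rw [hB]; ring
    simp only [h3]
    rw [key, hB]
    congr 1
    simp [add_assoc]
  rw [setLIntegral_congr_fun measurableSet_Ioo hfib]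
  have key := lintegral_Ioo_ofReal_of_hasDerivAt
    (F := fun v => v / (2 * a * (a + b) * (a + b + c * v)))
    (f := fun v => 1 / (2 * a * (a + b + c * v) ^ 2))
    (fun v hv => by
      have hv0 := hv.1
      have hpos : 0 < a + b + c * v := by positivity
      have h1 : HasDerivAt (fun v : ℝ => a + b + c * v) c v := by
        simpa using ((hasDerivAt_id v).const_mul c).const_add (a + b)
      have h2 := (hasDerivAt_id v).div (h1.const_mul (2 * a * (a + b))) (by positivity)
      refine h2.congr_deriv ?_
      simp only [id]
      field_simp
      ring)
    (ContinuousOn.div continuousOn_const (by fun_prop) fun v hv => by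
      have hv0 := hv.1
      positivity)
    (fun v hv => by have hv0 := hv.1; positivity)
  rw [key, projMass]
  simp

/-- Null sets of the unit square pull back to null sets, so almost every orbit of the triangle map
stays in the open square. -/
lemma quasiMeasurePreserving_triangleMap :
    Measure.QuasiMeasurePreserving triangleMap ((volume : Measure (ℝ × ℝ)).restrict unitSquare)
      ((volume : Measure (ℝ × ℝ)).restrict unitSquare) := by
  refine ⟨measurable_triangleMap, Measure.AbsolutelyContinuous.mk fun E hE hE0 => ?_⟩
  rw [Measure.map_apply measurable_triangleMap hE]
  have hG : Measurable (E.indicator (1 : ℝ × ℝ → ℝ≥0∞)) := measurable_one.indicator hE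
  have hGT : Measurable fun p => E.indicator (1 : ℝ × ℝ → ℝ≥0∞) (triangleMap p) :=
    hG.comp measurable_triangleMap
  -- any positive density will do; `projDensity 1 0 0` is `u`
  have h := lintegral_digit_mul_comp_triangleMap one_pos le_rfl le_rfl (fun _ => 1) hG
  have hE' : ∀ᵐ p ∂((volume : Measure (ℝ × ℝ)).restrict unitSquare), p ∉ E :=
    measure_eq_zero_iff_ae_notMem.1 hE0
  have hz : ∀ k : ℕ, ∫⁻ p in unitSquare, E.indicator (1 : ℝ × ℝ → ℝ≥0∞) p *
      projDensity (1 + 0) (1 * k + 0) 1 p = 0 := by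
    intro k
    rw [lintegral_eq_zero_iff (by fun_prop)]
    filter_upwards [hE'] with p hp
    simp [hp]
  simp only [one_mul] at h hz
  simp only [hz, tsum_zero] at h
  rw [lintegral_eq_zero_iff (by fun_prop)] at h
  refine measure_eq_zero_iff_ae_notMem.2 ?_
  filter_upwards [h, ae_restrict_mem measurableSet_unitSquare] with p hp hps hpE
  have hp1 := hps.1.1
  have hpE' : triangleMap p ∈ E := hpE
  simp [projDensity, hpE'] at hp
  linarith

lemma ae_iterate_triangleMap_mem :
    ∀ᵐ p ∂((volume : Measure (ℝ × ℝ)).restrict unitSquare),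
      ∀ j, triangleMap^[j] p ∈ unitSquare :=
  ae_all_iff.2 fun j => (quasiMeasurePreserving_triangleMap.iterate j).ae
    (ae_restrict_mem measurableSet_unitSquare)

/-! ### Superlinear growth of the digit sums -/

/-- The mass carried by the digits `≥ t`. -/
noncomputable def tailMass (a b c t : ℝ) : ℝ := 1 / (2 * a * (a + b) * (a + b + c + a * t))

lemma tailMass_zero (a b c : ℝ) : tailMass a b c 0 = projMass a b c := by
  simp [tailMass, projMass]

lemma projMass_eq_tailMass_sub {a b c : ℝ} (ha : 0 < a) (hb : 0 ≤ b) (hc : 0 ≤ c) (k : ℕ) :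
    projMass (a + b) (a * k + c) a = tailMass a b c k - tailMass a b c (k + 1) := by
  have h1 : 0 < a + b + c + a * k := by positivity
  have h2 : 0 < a + b + c + a * (k + 1) := by positivity
  have h3 : a + b + (a * k + c) = a + b + c + a * k := by ring
  have h4 : a + b + c + a * k + a = a + b + c + a * (k + 1) := by ring
  rw [projMass, tailMass, tailMass, h3, h4]
  field_simp
  ring

lemma tailMass_ge {a b c : ℝ} (ha : 0 < a) (hb : 0 ≤ b) (hc : 0 ≤ c) (k : ℕ) :
    projMass a b c / (k + 1) ≤ tailMass a b c k := by
  rw [projMass, tailMass, div_div]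
  refine one_div_le_one_div_of_le (by positivity) ?_
  rw [mul_assoc (2 * a * (a + b))]
  gcongr
  nlinarith [mul_nonneg hb (Nat.cast_nonneg (α := ℝ) k), mul_nonneg hc (Nat.cast_nonneg (α := ℝ) k)]

/-- Summation by parts: the mean of a decreasing weight against a distribution with tails `t`. -/
lemma sum_weight_mul_sub (φ t : ℕ → ℝ) (n : ℕ) :
    ∑ k ∈ Finset.range n, φ k * (t k - t (k + 1)) =
      φ 0 * t 0 - φ n * t n - ∑ k ∈ Finset.range n, (φ k - φ (k + 1)) * t (k + 1) := by
  induction n with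
  | zero => simp
  | succ n ih => rw [Finset.sum_range_succ, Finset.sum_range_succ, ih]; ring

/-- The weight `1 - min(k, L) / (2 L)`, a truncated linear substitute for `exp (-k / (2 L))`. -/
noncomputable def digitWeight (L k : ℕ) : ℝ := 1 - (min k L : ℕ) / (2 * L)

lemma half_le_digitWeight {L : ℕ} (hL : 0 < L) (k : ℕ) : 1 / 2 ≤ digitWeight L k := by
  have hL' : (0 : ℝ) < L := by exact_mod_cast hL
  have h1 : ((min k L : ℕ) : ℝ) ≤ L := by exact_mod_cast min_le_right k L
  have h2 : ((min k L : ℕ) : ℝ) / (2 * L) ≤ 1 / 2 := by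
    rw [div_le_div_iff₀ (by positivity) (by norm_num)]
    linarith
  rw [digitWeight]
  linarith

lemma exp_le_digitWeight {L : ℕ} (hL : 0 < L) (k : ℕ) :
    Real.exp (-(k / L)) ≤ digitWeight L k := by
  have hL' : (0 : ℝ) < L := by exact_mod_cast hL
  set x : ℝ := (min k L : ℕ) / (2 * L) with hx
  have hx0 : 0 ≤ x := by positivity
  have hx1 : x ≤ 1 / 2 := by
    have := half_le_digitWeight hL k
    rw [digitWeight] at this
    linarith
  have hk : 2 * x ≤ k / L := by
    have h1 : ((min k L : ℕ) : ℝ) ≤ k := by exact_mod_cast min_le_left k L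
    have h2 : 2 * x = (min k L : ℕ) / L := by rw [hx]; field_simp
    rw [h2]
    gcongr
  calc Real.exp (-(k / L)) ≤ Real.exp (-(2 * x)) := Real.exp_le_exp.2 (by linarith)
    _ ≤ 1 - x := by
      rw [Real.exp_neg, inv_le_iff_one_le_mul₀ (Real.exp_pos _)]
      have := Real.add_one_le_exp (2 * x)
      nlinarith
    _ = digitWeight L k := rfl

/-- The partial sums `1/2 + ⋯ + 1/(L+1)` of the harmonic series. -/
noncomputable def harmonicTail (L : ℕ) : ℝ := ∑ k ∈ Finset.range L, 1 / ((k : ℝ) + 2)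

lemma exists_harmonicTail_gt (K : ℝ) : ∃ L : ℕ, 0 < L ∧ K < harmonicTail L := by
  obtain ⟨L, h1, h2⟩ := ((Real.tendsto_sum_range_one_div_nat_succ_atTop.eventually_gt_atTop
    (2 * K)).and (eventually_gt_atTop 0)).exists
  refine ⟨L, h2, ?_⟩
  have : (1 / 2) * ∑ i ∈ Finset.range L, 1 / ((i : ℝ) + 1) ≤ harmonicTail L := by
    rw [Finset.mul_sum, harmonicTail]
    refine Finset.sum_le_sum fun i _ => ?_
    rw [one_div_mul_one_div]
    exact one_div_le_one_div_of_le (by positivity) (by linarith [Nat.cast_nonneg (α := ℝ) i])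
  linarith

lemma sum_digitWeight_mul_projMass_le {a b c : ℝ} (ha : 0 < a) (hb : 0 ≤ b) (hc : 0 ≤ c)
    {L : ℕ} (hL : 0 < L) (n : ℕ) :
    ∑ k ∈ Finset.range n, digitWeight L k * projMass (a + b) (a * k + c) a ≤
      Real.exp (-(harmonicTail L / (2 * L))) * projMass a b c := by
  have hL' : (0 : ℝ) < L := by exact_mod_cast hL
  have hm : 0 ≤ projMass a b c := by rw [projMass]; positivity
  have hw : ∀ k, 0 ≤ digitWeight L k := fun k => by linarith [half_le_digitWeight hL k]
  have ht : ∀ k : ℕ, 0 ≤ tailMass a b c k := fun k => by rw [tailMass]; positivity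
  have hdiff : ∀ k, k < L → digitWeight L k - digitWeight L (k + 1) = 1 / (2 * L) := by
    intro k hk
    rw [digitWeight, digitWeight, min_eq_left hk.le, min_eq_left hk]
    push_cast
    ring
  have hanti : ∀ k, 0 ≤ digitWeight L k - digitWeight L (k + 1) := by
    intro k
    have : ((min k L : ℕ) : ℝ) ≤ (min (k + 1) L : ℕ) := by
      exact_mod_cast min_le_min_right L (Nat.le_succ k)
    rw [digitWeight, digitWeight]
    have : ((min k L : ℕ) : ℝ) / (2 * L) ≤ (min (k + 1) L : ℕ) / (2 * L) := by gcongr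
    linarith
  calc ∑ k ∈ Finset.range n, digitWeight L k * projMass (a + b) (a * k + c) a
      ≤ ∑ k ∈ Finset.range (n + L), digitWeight L k * projMass (a + b) (a * k + c) a := by
        refine Finset.sum_le_sum_of_subset_of_nonneg
          (Finset.range_mono (Nat.le_add_right n L)) fun k _ _ => mul_nonneg (hw k) ?_
        rw [projMass]
        positivity
    _ = ∑ k ∈ Finset.range (n + L),
          digitWeight L k * (tailMass a b c k - tailMass a b c ((k + 1 : ℕ) : ℝ)) := by
        refine Finset.sum_congr rfl fun k _ => ?_
        rw [projMass_eq_tailMass_sub ha hb hc]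
        push_cast
        rfl
    _ ≤ projMass a b c - ∑ k ∈ Finset.range (n + L),
          (digitWeight L k - digitWeight L (k + 1)) * tailMass a b c ((k + 1 : ℕ) : ℝ) := by
        rw [sum_weight_mul_sub (digitWeight L) (fun k => tailMass a b c k)]
        have h1 := mul_nonneg (hw (n + L)) (ht (n + L))
        have h2 : digitWeight L 0 * tailMass a b c (0 : ℕ) = projMass a b c := by
          simp [digitWeight, tailMass_zero]
        rw [h2]
        linarith
    _ ≤ projMass a b c - ∑ k ∈ Finset.range L,
          (digitWeight L k - digitWeight L (k + 1)) * tailMass a b c ((k + 1 : ℕ) : ℝ) := by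
        refine sub_le_sub_left ?_ _
        exact Finset.sum_le_sum_of_subset_of_nonneg
          (Finset.range_mono (Nat.le_add_left L n)) fun k _ _ => mul_nonneg (hanti k) (ht _)
    _ ≤ projMass a b c - ∑ k ∈ Finset.range L,
          1 / (2 * L) * (projMass a b c * (1 / ((k : ℝ) + 2))) := by
        gcongr with k hk
        · exact hanti k
        · exact (hdiff k (Finset.mem_range.1 hk)).ge
        · have := tailMass_ge ha hb hc (k + 1)
          have h2 : (k : ℝ) + 2 = ((k + 1 : ℕ) : ℝ) + 1 := by push_cast; ring
          rw [mul_one_div, h2]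
          exact this
    _ = (1 - harmonicTail L / (2 * L)) * projMass a b c := by
        rw [← Finset.mul_sum, ← Finset.mul_sum, harmonicTail]
        ring
    _ ≤ _ := by
        gcongr
        linarith [Real.add_one_le_exp (-(harmonicTail L / (2 * L)))]

/-- The product of the weights of the first `N` digits. -/
noncomputable def weightProd (L N : ℕ) (p : ℝ × ℝ) : ℝ≥0∞ :=
  ∏ j ∈ Finset.range N, ENNReal.ofReal (digitWeight L (digit (triangleMap^[j] p)))

lemma weightProd_succ (L N : ℕ) (p : ℝ × ℝ) :
    weightProd L (N + 1) p =
      ENNReal.ofReal (digitWeight L (digit p)) * weightProd L N (triangleMap p) := by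
  simp only [weightProd, Finset.prod_range_succ', Function.iterate_succ_apply,
    Function.iterate_zero, id]
  rw [mul_comm]

@[fun_prop]
lemma measurable_weightProd (L N : ℕ) : Measurable (weightProd L N) := by
  unfold weightProd
  refine Finset.measurable_prod _ fun j _ => ENNReal.measurable_ofReal.comp ?_
  exact (measurable_from_nat (f := digitWeight L)).comp
    (measurable_digit.comp (measurable_triangleMap.iterate j))

/-- Exponential moment bound. It holds for all the densities simultaneously, which is what lets
the induction on `N` run: conditioning on a digit only changes the parameters. -/
lemma lintegral_weightProd_le {L : ℕ} (hL : 0 < L) (N : ℕ) :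
    ∀ a b c : ℝ, 0 < a → 0 ≤ b → 0 ≤ c →
      ∫⁻ p in unitSquare, weightProd L N p * projDensity a b c p ≤
        ENNReal.ofReal (Real.exp (-(harmonicTail L / (2 * L)))) ^ N *
          ENNReal.ofReal (projMass a b c) := by
  induction N with
  | zero =>
    intro a b c ha hb hc
    simp [weightProd, lintegral_projDensity ha hb hc]
  | succ N ih =>
    intro a b c ha hb hc
    have hw : ∀ k, 0 ≤ digitWeight L k := fun k => by linarith [half_le_digitWeight hL k]
    simp only [weightProd_succ]
    rw [lintegral_digit_mul_comp_triangleMap ha hb hc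
      (fun k => ENNReal.ofReal (digitWeight L k)) (measurable_weightProd L N)]
    set θ := ENNReal.ofReal (Real.exp (-(harmonicTail L / (2 * L)))) with hθ
    calc _ ≤ ∑' k : ℕ, ENNReal.ofReal (digitWeight L k) *
            (θ ^ N * ENNReal.ofReal (projMass (a + b) (a * k + c) a)) := by
          gcongr with k
          exact ih _ _ _ (by positivity) (by positivity) ha.le
      _ = θ ^ N * ∑' k : ℕ,
            ENNReal.ofReal (digitWeight L k * projMass (a + b) (a * k + c) a) := by
          rw [← ENNReal.tsum_mul_left]
          refine tsum_congr fun k => ?_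
          rw [ENNReal.ofReal_mul (hw k)]
          ring
      _ ≤ θ ^ N * (θ * ENNReal.ofReal (projMass a b c)) := by
          gcongr
          refine ENNReal.tsum_le_of_sum_range_le fun n => ?_
          rw [← ENNReal.ofReal_sum_of_nonneg, hθ, ← ENNReal.ofReal_mul (Real.exp_pos _).le]
          · exact ENNReal.ofReal_le_ofReal (sum_digitWeight_mul_projMass_le ha hb hc hL n)
          · intro k _
            refine mul_nonneg (hw k) ?_
            rw [projMass]
            positivity
      _ = θ ^ (N + 1) * ENNReal.ofReal (projMass a b c) := by rw [pow_succ, mul_assoc]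

lemma ofReal_exp_le_weightProd {L : ℕ} (hL : 0 < L) (N : ℕ) (p : ℝ × ℝ) :
    ENNReal.ofReal (Real.exp
      (-((∑ j ∈ Finset.range N, digit (triangleMap^[j] p) : ℕ) / (L : ℝ)))) ≤
      weightProd L N p := by
  have hsum : -(((∑ j ∈ Finset.range N, digit (triangleMap^[j] p) : ℕ) : ℝ) / (L : ℝ)) =
      ∑ j ∈ Finset.range N, -((digit (triangleMap^[j] p) : ℝ) / L) := by
    push_cast
    rw [Finset.sum_neg_distrib, Finset.sum_div]
  rw [hsum, Real.exp_sum, ENNReal.ofReal_prod_of_nonneg fun _ _ => (Real.exp_pos _).le, weightProd]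
  gcongr with j
  exact exp_le_digitWeight hL _

/-- The digit sums grow faster than `K N` for every `K`, almost everywhere. The truncation level
`L` is chosen so that the weighted product, multiplied by `exp (K N / L)`, is summable in `N`. -/
lemma ae_eventually_mul_le_sum_digit (K : ℕ) :
    ∀ᵐ p ∂((volume : Measure (ℝ × ℝ)).restrict unitSquare),
      ∀ᶠ N in atTop, K * N ≤ ∑ j ∈ Finset.range N, digit (triangleMap^[j] p) := by
  obtain ⟨L, hL, hKL⟩ := exists_harmonicTail_gt (2 * K)
  have hL' : (0 : ℝ) < L := by exact_mod_cast hL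
  set x : ℝ≥0∞ := ENNReal.ofReal (Real.exp (K / L)) with hx
  set θ : ℝ≥0∞ := ENNReal.ofReal (Real.exp (-(harmonicTail L / (2 * L)))) with hθ
  have hlt : x * θ < 1 := by
    rw [hx, hθ, ← ENNReal.ofReal_mul (Real.exp_pos _).le, ← Real.exp_add, ENNReal.ofReal_lt_one,
      Real.exp_lt_one_iff]
    have : (K : ℝ) / L = 2 * K / (2 * L) := by field_simp
    rw [this, ← sub_eq_add_neg, sub_neg]
    gcongr
  have hmeas : ∀ N, Measurable fun p => x ^ N * (weightProd L N p * projDensity 1 0 0 p) :=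
    fun N => by fun_prop
  have hfin : ∫⁻ p in unitSquare,
      ∑' N : ℕ, x ^ N * (weightProd L N p * projDensity 1 0 0 p) ≠ ∞ := by
    rw [lintegral_tsum fun N => (hmeas N).aemeasurable]
    refine ne_top_of_le_ne_top ?_ (ENNReal.tsum_le_tsum (g := fun N =>
      (x * θ) ^ N * ENNReal.ofReal (projMass 1 0 0)) fun N => ?_)
    · rw [ENNReal.tsum_mul_right, ENNReal.tsum_geometric]
      exact ENNReal.mul_ne_top (ENNReal.inv_ne_top.2 (tsub_pos_of_lt hlt).ne')
        ENNReal.ofReal_ne_top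
    · rw [lintegral_const_mul _ (by fun_prop), mul_pow, mul_assoc]
      gcongr
      exact lintegral_weightProd_le hL N 1 0 0 one_pos le_rfl le_rfl
  filter_upwards [ae_lt_top' (Measurable.tsum hmeas).aemeasurable hfin,
    ae_restrict_mem measurableSet_unitSquare] with p hp hps
  have hD : projDensity 1 0 0 p ≠ 0 := by
    have := hps.1.1
    simp [projDensity, this]
  have hlim := ENNReal.tendsto_atTop_zero_of_tsum_ne_top hp.ne
  filter_upwards [hlim.eventually (gt_mem_nhds (pos_iff_ne_zero.2 hD))] with N hN
  by_contra! hcon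
  refine absurd hN (not_lt.2 ?_)
  rw [← mul_assoc]
  refine le_mul_of_one_le_left zero_le ?_
  calc (1 : ℝ≥0∞) ≤ ENNReal.ofReal (Real.exp (K / L) ^ N * Real.exp
        (-((∑ j ∈ Finset.range N, digit (triangleMap^[j] p) : ℕ) / (L : ℝ)))) := by
        rw [← Real.exp_nat_mul, ← Real.exp_add, ENNReal.one_le_ofReal, Real.one_le_exp_iff,
          ← sub_eq_add_neg, sub_nonneg, ← mul_div_assoc]
        gcongr
        rw [mul_comm]
        exact_mod_cast hcon.le
    _ ≤ x ^ N * weightProd L N p := by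
        rw [ENNReal.ofReal_mul (by positivity), ENNReal.ofReal_pow (Real.exp_pos _).le]
        gcongr
        exact ofReal_exp_le_weightProd hL N p

/-! ### From the unit square to the strip -/

/-- A property that holds almost everywhere on the unit square and pulls back under the strip map
holds almost everywhere on the strip: `(u,v)` descends to `(u, v - ⌊v⌋)`. -/
lemma ae_stripMeasure_of_ae_unitSquare {P : ℝ × ℝ → Prop}
    (hP : ∀ p, P (stripMap p) → P p)
    (h : ∀ᵐ p ∂((volume : Measure (ℝ × ℝ)).restrict unitSquare), P p) :
    ∀ᵐ p ∂stripMeasure, P p := by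
  have hiter : ∀ (m : ℕ) p, P (stripMap^[m] p) → P p := by
    intro m
    induction m with
    | zero => exact fun p hp => hp
    | succ m ih => exact fun p hp => hP p (ih _ (by rwa [Function.iterate_succ_apply] at hp))
  rw [ae_restrict_iff' measurableSet_unitSquare] at h
  have htrans : ∀ᵐ p : ℝ × ℝ, ∀ m : ℕ, p + (0, -(m : ℝ)) ∈ unitSquare → P (p + (0, -(m : ℝ))) :=
    ae_all_iff.2 fun m =>
      (measurePreserving_add_right (volume : Measure (ℝ × ℝ))
        (0, -(m : ℝ))).quasiMeasurePreserving.ae h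
  have hu : ∀ᵐ p : ℝ × ℝ, p.1 ≠ 1 :=
    Measure.quasiMeasurePreserving_fst.ae (Measure.ae_ne volume 1)
  have hv : ∀ᵐ p : ℝ × ℝ, p.2 ∉ range ((↑) : ℕ → ℝ) :=
    Measure.quasiMeasurePreserving_snd.ae
      ((countable_range ((↑) : ℕ → ℝ)).ae_notMem volume)
  have hs : MeasurableSet strip := measurableSet_Ioc.prod measurableSet_Ici
  suffices hstrip : ∀ᵐ p ∂((volume : Measure (ℝ × ℝ)).restrict strip), P p from
    (withDensity_absolutelyContinuous _ _).ae_le hstrip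
  rw [ae_restrict_iff' hs]
  filter_upwards [htrans, hu, hv] with p hpt hpu hpv hps
  have hp2 : 0 ≤ p.2 := hps.2
  have hfl := Nat.floor_le hp2
  have hne : (⌊p.2⌋₊ : ℝ) ≠ p.2 := fun he => hpv ⟨_, he⟩
  refine hiter ⌊p.2⌋₊ p ?_
  have hstep : stripMap^[⌊p.2⌋₊] p = p + (0, -(⌊p.2⌋₊ : ℝ)) := by
    rw [← Prod.mk.eta (p := p), stripMap_iterate_of_le _ ⌊p.2⌋₊ _ hfl]
    ext <;> simp [sub_eq_add_neg]
  rw [hstep]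
  refine hpt _ ⟨?_, ?_⟩
  · simpa using ⟨hps.1.1, lt_of_le_of_ne hps.1.2 hpu⟩
  · have := Nat.lt_floor_add_one p.2
    have := lt_of_le_of_ne hfl hne
    constructor <;> simp only [Prod.snd_add] <;> linarith

/-! ### Convergence of the Birkhoff averages -/

theorem mainTheorem5 (α : ℝ) (hα : Irrational α) (g h : ℝ → ℝ)
    (hg : ∃ C : ℝ, ∀ u ∈ Ioo (0 : ℝ) 1, |g u| ≤ C)
    (hcont : Continuous h) (hper : Function.Periodic h α)
    (hconst : (∫ v in (0 : ℝ)..α, h v) ≠ 0 → ∃ c : ℝ, ∀ u ∈ Ioo (0 : ℝ) 1, g u = c)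
    (f : ℝ × ℝ → ℂ)
    (hf : ∀ u ∈ Ioo (0 : ℝ) 1, ∀ v ∈ Ici (0 : ℝ), f (u, v) = ((g u * h v : ℝ) : ℂ)) :
    ∃ fstar : ℂ, ∀ᵐ p ∂stripMeasure,
      Tendsto (fun n : ℕ => (1 / (n : ℂ)) * ∑ k ∈ Finset.range n, f (stripMap^[k] p))
        atTop (𝓝 fstar) := by
  obtain ⟨c, hc, hequi⟩ := exists_mean_of_periodic_irrational hα hcont hper
  obtain ⟨M, hM⟩ := hg
  -- either `c = 0` or `g` is constant, so `g u * c` does not depend on `u`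
  obtain ⟨s, hs⟩ : ∃ s : ℝ, ∀ u ∈ Ioo (0 : ℝ) 1, g u * c = s := by
    rcases eq_or_ne c 0 with h0 | h0
    · exact ⟨0, fun u _ => by rw [h0, mul_zero]⟩
    · obtain ⟨d, hd⟩ := hconst (hc h0)
      exact ⟨d * c, fun u hu => by rw [hd u hu]⟩
  let e : ℝ × ℝ → ℂ := fun p => f p - s
  have hcol : ∀ ε > 0, ∃ C : ℝ, ∀ u ∈ Ioo (0 : ℝ) 1, ∀ (v : ℝ) (m : ℕ), 0 ≤ v → (m : ℝ) ≤ v + 1 →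
      ‖∑ j ∈ Finset.range m, e (u, v - j)‖ ≤ ε * m + C := by
    intro ε hε
    obtain ⟨C, hC⟩ := hequi (ε / (|M| + 1)) (by positivity)
    refine ⟨(|M| + 1) * C, fun u hu v m hv hm => ?_⟩
    have hsum : ∑ j ∈ Finset.range m, e (u, v - j) =
        ((g u * ∑ j ∈ Finset.range m, (h (v - j) - c) : ℝ) : ℂ) := by
      rw [Finset.mul_sum, Complex.ofReal_sum]
      refine Finset.sum_congr rfl fun j hj => ?_
      have hj' : (j : ℝ) + 1 ≤ m := by exact_mod_cast Finset.mem_range.1 hj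
      have hvj : v - j ∈ Ici (0 : ℝ) := by
        rw [mem_Ici]
        linarith
      simp only [e]
      rw [hf u hu _ hvj, ← hs u hu]
      push_cast
      ring
    rw [hsum, Complex.norm_real, Real.norm_eq_abs, abs_mul]
    have hgM : |g u| ≤ |M| + 1 := by linarith [hM u hu, le_abs_self M]
    calc |g u| * |∑ j ∈ Finset.range m, (h (v - j) - c)|
        ≤ (|M| + 1) * (ε / (|M| + 1) * m + C) := by gcongr; exact hC v m
      _ = ε * m + (|M| + 1) * C := by field_simp
  refine ⟨s, ?_⟩
  have hlin : ∀ᵐ p ∂stripMeasure,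
      ∀ ε > 0, ∃ B : ℝ, ∀ n : ℕ, ‖birkhoffSum stripMap e n p‖ ≤ ε * n + B := by
    refine ae_stripMeasure_of_ae_unitSquare ?_ ?_
    · intro p hp ε hε
      obtain ⟨B, hB⟩ := hp ε hε
      refine ⟨‖e p‖ + |B|, fun n => ?_⟩
      rcases n with _ | n
      · simp only [birkhoffSum_zero, norm_zero]
        positivity
      · rw [birkhoffSum_succ']
        refine (norm_add_le _ _).trans ?_
        have := hB n
        have := le_abs_self B
        push_cast
        linarith
    · filter_upwards [ae_iterate_triangleMap_mem, ae_all_iff.2 ae_eventually_mul_le_sum_digit]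
        with p hp hgrow
      exact exists_norm_birkhoffSum_le_of_digit_sums hcol hp hgrow
  filter_upwards [hlin] with p hp
  rw [Metric.tendsto_atTop]
  intro ε hε
  obtain ⟨B, hB⟩ := hp (ε / 2) (by positivity)
  obtain ⟨n₀, hn₀⟩ := exists_nat_gt (2 * |B| / ε)
  refine ⟨n₀ + 1, fun n hn => ?_⟩
  have hn0 : (0 : ℝ) < n := by exact_mod_cast (by omega : 0 < n)
  have hnc : (n : ℂ) ≠ 0 := by exact_mod_cast hn0.ne'
  have hn1 : 2 * |B| / ε < n := hn₀.trans_le (by exact_mod_cast (by omega : n₀ ≤ n))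
  have heq : (1 / (n : ℂ)) * ∑ k ∈ Finset.range n, f (stripMap^[k] p) - s =
      1 / (n : ℂ) * birkhoffSum stripMap e n p := by
    simp only [birkhoffSum, e, Finset.sum_sub_distrib, Finset.sum_const, Finset.card_range,
      nsmul_eq_mul]
    field_simp
  rw [dist_eq_norm, heq, norm_mul, norm_div, norm_one, Complex.norm_natCast, one_div_mul_eq_div,
    div_lt_iff₀ hn0]
  have h1 : 2 * |B| < n * ε := (div_lt_iff₀ hε).1 hn1
  have h2 := hB n
  have h3 := le_abs_self B
  nlinarith
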